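/- Let $\nu\in(0,1)$ and $h,\lambda,c>0$. Let $\{U_k:k\ge1\}$ be i.i.d. positive random variables (claim sizes), independent of i.i.d. holding times $\{T_n:n\ge1\}$ with the generalized Mittag-Leffler density $\lambda^h t^{\nu h-1}E^h_{\nu,\nu h}(-\lambda t^\nu)1_{(0,\infty)}(t)$, where $E^\gamma_{\alpha,\beta}(x)=\sum_{r\ge0}\frac{(\gamma)_r x^r}{r!\,\Gamma(\alpha r+\beta)}$ and $(\gamma)_r=\gamma(\gamma+1)\cdots(\gamma+r-1)$. Put $M(t)=\sum_{n\ge1}1_{\{T_1+\cdots+T_n\le t\}}$ and $R(t)=u+ct-\sum_{k=1}^{M(t)}U_k$, and let $\Psi(u)=P(\exists t\ge0:R(t)<0)$ be the ruin probability with initial capital $u>0$. Let $P_U,P_T$ be the laws of $U_1,T_1$, and let $\tilde\kappa(\theta)=\log\mathbb E[e^{\theta U_1}]+\log\mathbb E[e^{-c\theta T_1}]\in(-\infty,\infty]$. Assume **(C1)** there is $w>0$ in the interior of $\{\theta\in\mathbb R:\tilde\kappa(\theta)<\infty\}$ with $\tilde\kappa(w)=0$. Let $Q_w=P_U^w\otimes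 P_T^w$, where $\frac{dP_U^w}{dP_U}(x)=\frac{e^{wx}}{\mathbb E[e^{wU_1}]}$ and $\frac{dP_T^w}{dP_T}(t)=\frac{e^{-cwt}}{\mathbb E[e^{-cwT_1}]}$. For a probability law $Q$ on $\mathbb R^2$ with $P_U\otimes P_T\ll Q$, simulate i.i.d. pairs $(U_k,T_k)$ with common law $Q$, let $\tau_u=\inf\{n\ge1:\sum_{k=1}^n(U_k-cT_k)>u\}$, and let $$Z_u^Q=1_{\{\tau_u<\infty\}}\prod_{k=1}^{\tau_u}\frac{d(P_U\otimes P_T)}{dQ}(U_k,T_k)$$ be the importance sampling estimator of $\Psi(u)$. Then $Q_w$ is an asymptotically optimal importance sampling distribution for the estimation of $\Psi(u)$ by simulation for large $u$. That is: $Q_w$ is a probability law with $P_U\otimes P_T\ll Q_w$; for all $u>0$ one has $\tau_u<\infty$ almost surely under $Q_w$ and $\mathbb E_{Q_w}[Z_u^{Q_w}]=\Psi(u)$; it is logarithmically efficient, $$\lim_{u\to\infty}\frac{\log\mathbb E_{Q_w}[(Z_u^{Q_w})^2]}{\log\Psi(u)}=2;$$ and its second moment has the smallest exponential rate, i.e.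 for every probability law $Q$ on $\mathbb R^2$ with $P_U\otimes P_T\ll Q$, $$\limsup_{u\to\infty}\frac1u\log\mathbb E_{Q_w}[(Z_u^{Q_w})^2]\le\liminf_{u\to\infty}\frac1u\log\mathbb E_{Q}[(Z_u^{Q})^2].$$ -/

import Mathlib

open MeasureTheory ProbabilityTheory Filter Topology
open scoped ENNReal

noncomputable section

namespace FractionalRuin

/-- The generalized Mittag-Leffler function
`E^γ_{α,β}(x) = ∑_{r ≥ 0} (γ)_r x^r / (r! Γ(α r + β))`, where `(γ)_r` is the rising factorial. -/
def genMittagLeffler (α β γ x : ℝ) : ℝ :=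
  ∑' r : ℕ, (ascPochhammer ℝ r).eval γ * x ^ r / ((r.factorial : ℝ) * Real.Gamma (α * r + β))

/-- The density `λ^h t^{νh-1} E^h_{ν,νh}(-λ t^ν) 1_{t > 0}` of a holding time. -/
def holdingDensity (ν h lam t : ℝ) : ℝ :=
  if 0 < t then
    lam ^ h * t ^ (ν * h - 1) * genMittagLeffler ν (ν * h) h (-lam * t ^ ν)
  else 0

/-- The generalized Mittag-Leffler distribution, the law of a holding time. -/
def holdingLaw (ν h lam : ℝ) : Measure ℝ :=
  volume.withDensity fun t => ENNReal.ofReal (holdingDensity ν h lam t)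

section Model

variable {Ω : Type*}

/-- The renewal process `M(t) = ∑_{n ≥ 1} 1_{T_1 + ⋯ + T_n ≤ t}`. The holding times are indexed
from `0`, so that `T_n` is `T (n - 1)`. -/
def claimNumber (T : ℕ → Ω → ℝ) (t : ℝ) (ω : Ω) : ℕ :=
  Set.ncard {n : ℕ | 1 ≤ n ∧ ∑ k ∈ Finset.range n, T k ω ≤ t}

/-- The reserve process `R(t) = u + c t - ∑_{k=1}^{M(t)} U_k` (claims indexed from `0`). -/
def reserve (c u : ℝ) (U T : ℕ → Ω → ℝ) (t : ℝ) (ω : Ω) : ℝ :=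
  u + c * t - ∑ k ∈ Finset.range (claimNumber T t ω), U k ω

/-- The ruin probability `Ψ(u) = P(∃ t ≥ 0, R(t) < 0)`. -/
def ruinProb [MeasurableSpace Ω] (P : Measure Ω) (c : ℝ) (U T : ℕ → Ω → ℝ) (u : ℝ) : ℝ≥0∞ :=
  P {ω | ∃ t : ℝ, 0 ≤ t ∧ reserve c u U T t ω < 0}

end Model

/-- `κ̃(θ) = log E[e^{θ U}] + log E[e^{-cθ T}]`, with values in the extended reals, where
`U` has law `PU` and `T` has law `PT`. -/
def cumulant (c : ℝ) (PU PT : Measure ℝ) (θ : ℝ) : EReal :=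
  ENNReal.log (∫⁻ x, ENNReal.ofReal (Real.exp (θ * x)) ∂PU) +
    ENNReal.log (∫⁻ t, ENNReal.ofReal (Real.exp (-c * θ * t)) ∂PT)

/-- The exponentially tilted product law `PU^θ ⊗ PT^θ`, with `dPU^θ/dPU (x) = e^{θ x} / E[e^{θ U}]`
and `dPT^θ/dPT (t) = e^{-cθ t} / E[e^{-cθ T}]`. -/
def tiltedLaw (c : ℝ) (PU PT : Measure ℝ) (θ : ℝ) : Measure (ℝ × ℝ) :=
  (PU.tilted fun x => θ * x).prod (PT.tilted fun t => -c * θ * t)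

/-- The random walk `∑_{k=1}^n (U_k - c T_k)` along a sequence `x` of pairs `(U, T)`. -/
def walk (c : ℝ) (x : ℕ → ℝ × ℝ) (n : ℕ) : ℝ :=
  ∑ k ∈ Finset.range n, ((x k).1 - c * (x k).2)

/-- The claim numbers at which the walk is above `u`. -/
def crossings (c u : ℝ) (x : ℕ → ℝ × ℝ) : Set ℕ :=
  {n | 1 ≤ n ∧ u < walk c x n}

open Classical in
/-- The importance sampling estimator of the ruin probability when an i.i.d. sequence `x` of
pairs is simulated from `Q` in place of `P`: with `τ` the index of the first crossing of `u`, it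
is the likelihood ratio `∏_{k ≤ τ} dP/dQ (x_k)` if `τ < ∞`, and `0` otherwise. -/
def estimator (c : ℝ) (P Q : Measure (ℝ × ℝ)) (u : ℝ) (x : ℕ → ℝ × ℝ) : ℝ≥0∞ :=
  if (crossings c u x).Nonempty then
    ∏ k ∈ Finset.range (sInf (crossings c u x)), P.rnDeriv Q (x k)
  else 0

/-- The law of an i.i.d. sequence of pairs with common law `Q`. -/
def pathLaw (Q : Measure (ℝ × ℝ)) : Measure (ℕ → ℝ × ℝ) :=
  Measure.infinitePi fun _ => Q

/-- The second moment, under `Q`, of the importance sampling estimator. -/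
def secondMoment (c : ℝ) (P Q : Measure (ℝ × ℝ)) (u : ℝ) : ℝ≥0∞ :=
  ∫⁻ x, estimator c P Q u x ^ 2 ∂pathLaw Q

/-- An admissible simulation law: a probability law with respect to which the original law `P`
is absolutely continuous. -/
structure IsSimulationLaw (P Q : Measure (ℝ × ℝ)) : Prop where
  isProbabilityMeasure : IsProbabilityMeasure Q
  absolutelyContinuous : P ≪ Q

/-- `Q` is an asymptotically optimal importance sampling law for the estimation of `Ψ(u)`,
for large `u`, where `P` is the original law of the pairs. -/
structure IsAsymptoticallyOptimal (c : ℝ) (Ψ : ℝ → ℝ≥0∞) (P Q : Measure (ℝ × ℝ)) : Prop where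
  /-- `Q` is admissible. -/
  isSimulationLaw : IsSimulationLaw P Q
  /-- A simulation run under `Q` ends after finitely many claims. -/
  terminates : ∀ u : ℝ, 0 < u → ∀ᵐ x ∂pathLaw Q, (crossings c u x).Nonempty
  /-- The estimator is unbiased. -/
  unbiased : ∀ u : ℝ, 0 < u → ∫⁻ x, estimator c P Q u x ∂pathLaw Q = Ψ u
  /-- Logarithmic efficiency: the second moment has the exponential order of `Ψ(u)^2`. -/
  logEfficient :
    Tendsto (fun u : ℝ => ENNReal.log (secondMoment c P Q u) / ENNReal.log (Ψ u)) atTop (𝓝 2)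
  /-- No admissible law has a second moment with a smaller exponential rate. -/
  minimal : ∀ Q' : Measure (ℝ × ℝ), IsSimulationLaw P Q' →
    limsup (fun u : ℝ => ENNReal.log (secondMoment c P Q u) / (u : EReal)) atTop ≤
      liminf (fun u : ℝ => ENNReal.log (secondMoment c P Q' u) / (u : EReal)) atTop

end FractionalRuin

end

/-! Write X = U - cT for the increments and S for their walk; ruin means that S crosses u
(`ruin_iff_crossings_nonempty`). Since κ̃(w) = 0 says E[e^{wX}] = 1, the tilted law Q satisfies
dP/dQ = e^{-wX}, and the likelihood ratio of n steps is e^{-w S_n}. At a crossing S_n > u, so the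
estimator is at most e^{-wu}; this bounds Ψ(u) by e^{-wu} and the second moment by e^{-2wu}.
Conversely, every admissible law gives an unbiased estimator (`lintegral_estimator`), so by
Cauchy-Schwarz its second moment is at least Ψ(u)^2 (`sq_le_secondMoment`). It remains to see that
Ψ(u) ≥ e^{-w(1+δ)u} for large u, for each δ > 0. By strict Jensen S has positive drift μ under Q
(`integral_increment_pos`), so by the law of large numbers S_n lies in (u, (1+δ)u] with
Q-probability tending to 1 for n about (1+δ/2)u/μ. There the likelihood ratio is at least
e^{-w(1+δ)u}, and changing back to P gives the bound (`eventually_exp_le_measure_crossings`). Of the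
Mittag-Leffler law only positivity and the absence of atoms matter. -/

namespace FractionalRuin

/-! ### Change of measure over finitely many terms of an i.i.d. sequence -/

section ChangeOfMeasure

variable {E : Type*} [MeasurableSpace E]

/-- Reweighting an i.i.d. sequence by the likelihood ratios of its first `n` terms changes the law
of these terms. -/
lemma infinitePi_withDensity_prod_rnDeriv (P Q : Measure E) [IsProbabilityMeasure P]
    [IsProbabilityMeasure Q] (hPQ : P ≪ Q) (n : ℕ)
    [∀ k : ℕ, IsProbabilityMeasure (if k < n then P else Q)] :
    (Measure.infinitePi fun _ : ℕ => Q).withDensity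
        (fun x => ∏ k ∈ Finset.range n, P.rnDeriv Q (x k)) =
      Measure.infinitePi fun k : ℕ => if k < n then P else Q := by
  refine Measure.eq_infinitePi _ fun s t ht => ?_
  classical
  have hbox : MeasurableSet (Set.pi (s : Set ℕ) t) := .pi s.countable_toSet fun _ _ => ht _
  have hf := Measure.measurable_rnDeriv P Q
  -- Indicator of the box and likelihood ratio are merged into one factor per coordinate, so that
  -- independence splits the integral.
  let g : ℕ → E → ℝ≥0∞ := fun k y =>
    (if k ∈ s then (t k).indicator 1 y else 1) * (if k < n then P.rnDeriv Q y else 1)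
  have hg : ∀ k, Measurable (g k) := by
    intro k
    refine Measurable.mul ?_ ?_
    · split_ifs
      · exact measurable_one.indicator (ht k)
      · exact measurable_const
    · split_ifs
      · exact hf
      · exact measurable_const
  have key : ∀ x : ℕ → E, (Set.pi (s : Set ℕ) t).indicator
      (fun x => ∏ k ∈ Finset.range n, P.rnDeriv Q (x k)) x =
      ∏ k ∈ s ∪ Finset.range n, g k (x k) := by
    intro x
    simp only [g, Finset.prod_mul_distrib]
    have h1 : ∏ k ∈ s ∪ Finset.range n, (if k ∈ s then (t k).indicator (1 : E → ℝ≥0∞) (x k) else 1)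
        = (Set.pi (s : Set ℕ) t).indicator 1 x := by
      rw [← Finset.prod_subset (s₁ := s) Finset.subset_union_left (by
        intro k _ hk; simp [hk])]
      by_cases hx : x ∈ Set.pi (s : Set ℕ) t
      · rw [Set.indicator_of_mem hx]
        refine Finset.prod_eq_one fun k hk => ?_
        rw [if_pos hk, Set.indicator_of_mem (hx k hk)]
        rfl
      · rw [Set.indicator_of_notMem hx]
        simp only [Set.mem_pi, not_forall] at hx
        obtain ⟨k, hk, hxk⟩ := hx
        refine Finset.prod_eq_zero hk ?_
        rw [if_pos (by simpa using hk), Set.indicator_of_notMem hxk]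
    have h2 : ∏ k ∈ s ∪ Finset.range n, (if k < n then P.rnDeriv Q (x k) else 1)
        = ∏ k ∈ Finset.range n, P.rnDeriv Q (x k) := by
      rw [← Finset.prod_subset (s₁ := Finset.range n) Finset.subset_union_right (by
        intro k _ hk; simp at hk; simp [hk])]
      exact Finset.prod_congr rfl fun k hk => by simp at hk; simp [hk]
    rw [h1, h2]
    by_cases hx : x ∈ Set.pi (s : Set ℕ) t <;> simp [hx]
  rw [withDensity_apply _ hbox, ← lintegral_indicator hbox]
  simp_rw [key]
  rw [lintegral_prod_eq_prod_lintegral_of_indepFun _ (fun k (x : ℕ → E) => g k (x k))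
    (iIndepFun_infinitePi (P := fun _ : ℕ => Q) hg) (fun k => (hg k).comp (measurable_pi_apply k))]
  have hint : ∀ k, ∫⁻ x, g k (x k) ∂(Measure.infinitePi fun _ : ℕ => Q) =
      if k ∈ s then (if k < n then P else Q) (t k) else 1 := by
    intro k
    rw [(measurePreserving_eval_infinitePi (fun _ : ℕ => Q) k).lintegral_comp (hg k)]
    by_cases hk : k ∈ s <;> by_cases hn : k < n
    · simp only [g, hk, hn, if_true]
      have : ∀ y, (t k).indicator (1 : E → ℝ≥0∞) y * P.rnDeriv Q y =
          (t k).indicator (P.rnDeriv Q) y := by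
        intro y
        by_cases hy : y ∈ t k <;> simp [hy]
      simp_rw [this]
      rw [lintegral_indicator (ht k), Measure.setLIntegral_rnDeriv hPQ]
    · simp only [g, hk, hn, if_true, if_false, mul_one]
      exact lintegral_indicator_one (ht k)
    · simp only [g, hk, hn, if_true, if_false, one_mul]
      rw [Measure.lintegral_rnDeriv hPQ, measure_univ]
    · simp [g, hk, hn]
  simp_rw [hint]
  rw [← Finset.prod_subset (s₁ := s) Finset.subset_union_left (by intro k _ hk; simp [hk])]
  exact Finset.prod_congr rfl fun k hk => by simp [hk]

/-- Overwriting the coordinates from `n` on by a fixed point does not affect `A`, and it sends both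
product measures to the same one. -/
lemma infinitePi_apply_congr_of_dependsOn (μ ν : ℕ → Measure E) [∀ k, IsProbabilityMeasure (μ k)]
    [∀ k, IsProbabilityMeasure (ν k)] (n : ℕ) (h : ∀ k < n, μ k = ν k) {A : Set (ℕ → E)}
    (hA : MeasurableSet A) (hdep : DependsOn (· ∈ A) (Set.Iio n)) :
    Measure.infinitePi μ A = Measure.infinitePi ν A := by
  have : Nonempty E := nonempty_of_isProbabilityMeasure (μ 0)
  let x₀ : E := Classical.arbitrary E
  let f : ℕ → E → E := fun k y => if k < n then y else x₀
  have hf : ∀ k, Measurable (f k) := by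
    intro k
    by_cases hk : k < n
    · simpa [f, hk] using measurable_id'
    · simp [f, hk]
  have hpre : (fun (x : ℕ → E) k => f k (x k)) ⁻¹' A = A := by
    ext x
    exact iff_of_eq (hdep fun k hk => if_pos hk)
  have hm : Measurable fun (x : ℕ → E) k => f k (x k) :=
    measurable_pi_lambda _ fun k => (hf k).comp (measurable_pi_apply k)
  have (k : ℕ) : IsProbabilityMeasure ((μ k).map (f k)) :=
    Measure.isProbabilityMeasure_map (hf k).aemeasurable
  have (k : ℕ) : IsProbabilityMeasure ((ν k).map (f k)) :=
    Measure.isProbabilityMeasure_map (hf k).aemeasurable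
  have hmap : ∀ k, (μ k).map (f k) = (ν k).map (f k) := by
    intro k
    by_cases hk : k < n
    · rw [h k hk]
    · have : f k = fun _ => x₀ := by ext y; simp [f, hk]
      simp [this]
  conv_lhs => rw [← hpre, ← Measure.map_apply hm hA, Measure.infinitePi_map_pi _ hf]
  conv_rhs => rw [← hpre, ← Measure.map_apply hm hA, Measure.infinitePi_map_pi _ hf]
  simp_rw [hmap]

/-- Change of measure for an event which is determined by the first `n` terms of an i.i.d.
sequence. -/
lemma setLIntegral_prod_rnDeriv (P Q : Measure E) [IsProbabilityMeasure P]
    [IsProbabilityMeasure Q] (hPQ : P ≪ Q) (n : ℕ) {A : Set (ℕ → E)} (hA : MeasurableSet A)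
    (hdep : DependsOn (· ∈ A) (Set.Iio n)) :
    ∫⁻ x in A, ∏ k ∈ Finset.range n, P.rnDeriv Q (x k) ∂(Measure.infinitePi fun _ : ℕ => Q) =
      Measure.infinitePi (fun _ : ℕ => P) A := by
  have (k : ℕ) : IsProbabilityMeasure (if k < n then P else Q) := by split_ifs <;> infer_instance
  rw [← withDensity_apply _ hA, infinitePi_withDensity_prod_rnDeriv P Q hPQ n]
  exact infinitePi_apply_congr_of_dependsOn _ _ n (fun k hk => if_pos hk) hA hdep

end ChangeOfMeasure

lemma sq_lintegral_le_lintegral_sq {α : Type*} [MeasurableSpace α] (μ : Measure α)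
    [IsProbabilityMeasure μ] {f : α → ℝ≥0∞} (hf : AEMeasurable f μ) :
    (∫⁻ x, f x ∂μ) ^ 2 ≤ ∫⁻ x, f x ^ 2 ∂μ := by
  have h := ENNReal.lintegral_mul_le_Lp_mul_Lq μ Real.HolderConjugate.two_two hf
    (aemeasurable_const (b := (1 : ℝ≥0∞)))
  simp only [Pi.mul_apply, mul_one, ENNReal.one_rpow, lintegral_const, measure_univ] at h
  calc (∫⁻ x, f x ∂μ) ^ 2 ≤ ((∫⁻ x, f x ^ (2 : ℝ) ∂μ) ^ (1 / 2 : ℝ)) ^ 2 := by gcongr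
    _ = ∫⁻ x, f x ^ 2 ∂μ := by
      rw [← ENNReal.rpow_natCast, ← ENNReal.rpow_mul]
      simp

/-! ### Unbiasedness and the universal lower bound on the second moment -/

section Estimator

variable (c : ℝ) (P Q : Measure (ℝ × ℝ))

lemma measurable_walk (n : ℕ) : Measurable fun x => walk c x n := by
  unfold walk
  fun_prop

lemma dependsOn_walk {m n : ℕ} (hmn : m ≤ n) :
    DependsOn (fun x => walk c x m) (Set.Iio n) := by
  intro x y h
  refine Finset.sum_congr rfl fun k hk => ?_
  rw [h k ((Finset.mem_range.1 hk).trans_le hmn)]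

/-- The paths which cross the level `u` for the first time at `n`. -/
def firstCrossing (u : ℝ) (n : ℕ) : Set (ℕ → ℝ × ℝ) :=
  {x | 1 ≤ n ∧ u < walk c x n ∧ ∀ m < n, 1 ≤ m → walk c x m ≤ u}

lemma measurableSet_firstCrossing (u : ℝ) (n : ℕ) : MeasurableSet (firstCrossing c u n) := by
  have h := measurable_walk c
  have : firstCrossing c u n = {_x | 1 ≤ n} ∩ ({x | u < walk c x n} ∩
      ⋂ m, ⋂ (_ : m < n), ⋂ (_ : 1 ≤ m), {x | walk c x m ≤ u}) := by
    ext x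
    simp [firstCrossing]
  rw [this]
  refine (MeasurableSet.const _).inter ((measurableSet_lt measurable_const (h n)).inter ?_)
  exact .iInter fun m => .iInter fun _ => .iInter fun _ => measurableSet_le (h m) measurable_const

lemma dependsOn_firstCrossing (u : ℝ) (n : ℕ) :
    DependsOn (· ∈ firstCrossing c u n) (Set.Iio n) := by
  intro x y h
  have hw : ∀ m ≤ n, walk c x m = walk c y m := fun m hm => dependsOn_walk c hm h
  simp only [firstCrossing, Set.mem_ofPred_eq, hw n le_rfl, eq_iff_iff]
  refine and_congr_right fun _ => and_congr_right fun _ => forall₂_congr fun m hm => ?_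
  rw [hw m hm.le]

lemma mem_firstCrossing_iff (u : ℝ) (n : ℕ) (x : ℕ → ℝ × ℝ) :
    x ∈ firstCrossing c u n ↔ (crossings c u x).Nonempty ∧ sInf (crossings c u x) = n := by
  constructor
  · rintro ⟨h1, h2, h3⟩
    have hn : n ∈ crossings c u x := ⟨h1, h2⟩
    refine ⟨⟨n, hn⟩, le_antisymm (Nat.sInf_le hn) ?_⟩
    by_contra! hlt
    obtain ⟨h4, h5⟩ := Nat.sInf_mem ⟨n, hn⟩
    exact absurd h5 (not_lt.2 (h3 _ hlt h4))
  · rintro ⟨hne, rfl⟩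
    obtain ⟨h4, h5⟩ := Nat.sInf_mem hne
    refine ⟨h4, h5, fun m hm hm1 => ?_⟩
    by_contra! hlt
    exact Nat.notMem_of_lt_sInf hm ⟨hm1, hlt⟩

lemma pairwise_disjoint_firstCrossing (u : ℝ) :
    Pairwise (Function.onFun Disjoint (firstCrossing c u)) := by
  intro m n hmn
  refine Set.disjoint_left.2 fun x hm hn => hmn ?_
  rw [mem_firstCrossing_iff] at hm hn
  exact hm.2.symm.trans hn.2

lemma iUnion_firstCrossing (u : ℝ) :
    ⋃ n, firstCrossing c u n = {x | (crossings c u x).Nonempty} := by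
  ext x
  simp [mem_firstCrossing_iff]

/-- Splitting by the time of first crossing replaces the random number of factors by a fixed one, to
which the finite change of measure applies. -/
lemma estimator_eq_tsum (u : ℝ) (x : ℕ → ℝ × ℝ) :
    estimator c P Q u x = ∑' n, (firstCrossing c u n).indicator
      (fun x => ∏ k ∈ Finset.range n, P.rnDeriv Q (x k)) x := by
  classical
  by_cases h : (crossings c u x).Nonempty
  · rw [tsum_eq_single (sInf (crossings c u x))]
    · rw [Set.indicator_of_mem ((mem_firstCrossing_iff c u _ x).2 ⟨h, rfl⟩)]
      simp [estimator, h]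
    · intro n hn
      refine Set.indicator_of_notMem (fun hx => hn ?_) _
      exact ((mem_firstCrossing_iff c u _ x).1 hx).2.symm
  · have : ∀ n, x ∉ firstCrossing c u n := fun n hx => h ((mem_firstCrossing_iff c u _ x).1 hx).1
    simp [estimator, h, this]

lemma measurable_prod_rnDeriv (n : ℕ) :
    Measurable fun x : ℕ → ℝ × ℝ => ∏ k ∈ Finset.range n, P.rnDeriv Q (x k) :=
  Finset.measurable_prod _ fun k _ =>
    (Measure.measurable_rnDeriv P Q).comp (measurable_pi_apply k)

lemma measurable_estimator (u : ℝ) : Measurable (estimator c P Q u) := by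
  have : estimator c P Q u = fun x => ∑' n, (firstCrossing c u n).indicator
      (fun x => ∏ k ∈ Finset.range n, P.rnDeriv Q (x k)) x :=
    funext fun x => estimator_eq_tsum c P Q u x
  rw [this]
  exact Measurable.tsum fun n =>
    (measurable_prod_rnDeriv P Q n).indicator (measurableSet_firstCrossing c u n)

lemma lintegral_estimator [IsProbabilityMeasure P] [IsProbabilityMeasure Q] (hPQ : P ≪ Q) (u : ℝ) :
    ∫⁻ x, estimator c P Q u x ∂pathLaw Q = pathLaw P {x | (crossings c u x).Nonempty} := by
  have hm := measurableSet_firstCrossing c u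
  simp_rw [estimator_eq_tsum]
  rw [lintegral_tsum fun n => ((measurable_prod_rnDeriv P Q n).indicator (hm n)).aemeasurable,
    ← iUnion_firstCrossing, measure_iUnion (pairwise_disjoint_firstCrossing c u) hm]
  refine tsum_congr fun n => ?_
  rw [lintegral_indicator (hm n)]
  exact setLIntegral_prod_rnDeriv P Q hPQ n (hm n) (dependsOn_firstCrossing c u n)

lemma sq_le_secondMoment [IsProbabilityMeasure P] [IsProbabilityMeasure Q] (hPQ : P ≪ Q) (u : ℝ) :
    pathLaw P {x | (crossings c u x).Nonempty} ^ 2 ≤ secondMoment c P Q u := by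
  have : IsProbabilityMeasure (pathLaw Q) := by unfold pathLaw; infer_instance
  rw [← lintegral_estimator c P Q hPQ]
  exact sq_lintegral_le_lintegral_sq _ (measurable_estimator c P Q u).aemeasurable

end Estimator

/-! ### Exponential change of measure: drift, upper and lower bounds -/

section ExponentialChange

variable {c w : ℝ} {P Q : Measure (ℝ × ℝ)}

instance [IsProbabilityMeasure Q] : IsProbabilityMeasure (pathLaw Q) := by
  unfold pathLaw
  infer_instance

/-- Strict Jensen: e^{-wX} has `Q`-mean 1, so integrating e^{-wX} - 1 + wX ≥ 0 gives w E[X] ≥ 0, and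
equality would force X = 0 almost surely. -/
lemma integral_increment_pos [IsProbabilityMeasure P] [IsProbabilityMeasure Q] (hw : 0 < w)
    (hPQ : P ≪ Q)
    (hrn : P.rnDeriv Q =ᵐ[Q] fun z => ENNReal.ofReal (Real.exp (-(w * (z.1 - c * z.2)))))
    (hint : Integrable (fun z : ℝ × ℝ => z.1 - c * z.2) Q)
    (hne : ¬ ∀ᵐ z ∂Q, z.1 - c * z.2 = 0) :
    0 < ∫ z, (z.1 - c * z.2) ∂Q := by
  have hexp : ∫⁻ z, ENNReal.ofReal (Real.exp (-(w * (z.1 - c * z.2)))) ∂Q = 1 := by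
    rw [← lintegral_congr_ae hrn, Measure.lintegral_rnDeriv hPQ, measure_univ]
  have hexpm : AEStronglyMeasurable (fun z : ℝ × ℝ => Real.exp (-(w * (z.1 - c * z.2)))) Q := by
    fun_prop
  have hexpi : Integrable (fun z : ℝ × ℝ => Real.exp (-(w * (z.1 - c * z.2)))) Q := by
    refine (lintegral_ofReal_ne_top_iff_integrable hexpm (ae_of_all _ fun _ => by positivity)).1 ?_
    simp [hexp]
  have hexp1 : ∫ z, Real.exp (-(w * (z.1 - c * z.2))) ∂Q = 1 := by
    rw [integral_eq_lintegral_of_nonneg_ae (ae_of_all _ fun _ => by positivity) hexpm, hexp]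
    simp
  have hnn : ∀ z : ℝ × ℝ,
      0 ≤ Real.exp (-(w * (z.1 - c * z.2))) - 1 + w * (z.1 - c * z.2) := fun z => by
    linarith [Real.add_one_le_exp (-(w * (z.1 - c * z.2)))]
  have hi : Integrable (fun z : ℝ × ℝ =>
      Real.exp (-(w * (z.1 - c * z.2))) - 1 + w * (z.1 - c * z.2)) Q :=
    (hexpi.sub (integrable_const 1)).add (hint.const_mul w)
  have hval : ∫ z, (Real.exp (-(w * (z.1 - c * z.2))) - 1 + w * (z.1 - c * z.2)) ∂Q =
      w * ∫ z, (z.1 - c * z.2) ∂Q := by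
    have h1 : Integrable (fun z : ℝ × ℝ => Real.exp (-(w * (z.1 - c * z.2))) - 1) Q :=
      hexpi.sub (integrable_const 1)
    rw [integral_add h1 (hint.const_mul w),
      integral_sub hexpi (integrable_const 1), hexp1, integral_const_mul]
    simp
  have hpos : 0 < ∫ z, (Real.exp (-(w * (z.1 - c * z.2))) - 1 + w * (z.1 - c * z.2)) ∂Q := by
    refine lt_of_le_of_ne (integral_nonneg hnn) fun h0 => hne ?_
    have h := (integral_eq_zero_iff_of_nonneg hnn hi).1 h0.symm
    filter_upwards [h] with z hz
    by_contra hz0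
    have := Real.add_one_lt_exp (x := -(w * (z.1 - c * z.2))) (by simp [hw.ne', hz0])
    simp only [Pi.zero_apply] at hz
    linarith
  rw [hval] at hpos
  exact pos_of_mul_pos_right hpos hw.le

lemma tendsto_walk_div [IsProbabilityMeasure Q]
    (hint : Integrable (fun z : ℝ × ℝ => z.1 - c * z.2) Q) :
    ∀ᵐ x ∂pathLaw Q, Tendsto (fun n : ℕ => walk c x n / n) atTop
      (𝓝 (∫ z, (z.1 - c * z.2) ∂Q)) := by
  have hX : Measurable fun z : ℝ × ℝ => z.1 - c * z.2 := by fun_prop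
  have hev := fun k => measurePreserving_eval_infinitePi (fun _ : ℕ => Q) k
  have hind : iIndepFun (fun (k : ℕ) (x : ℕ → ℝ × ℝ) => (x k).1 - c * (x k).2) (pathLaw Q) :=
    iIndepFun_infinitePi (P := fun _ : ℕ => Q) (X := fun _ z => z.1 - c * z.2) fun _ => hX
  have h := strong_law_ae_real (μ := pathLaw Q)
    (fun (k : ℕ) (x : ℕ → ℝ × ℝ) => (x k).1 - c * (x k).2)
    ((hev 0).integrable_comp_of_integrable hint)
    (fun i j hij => hind.indepFun hij) (fun i => ?_)
  · have hmean : (pathLaw Q)[fun x : ℕ → ℝ × ℝ => (x 0).1 - c * (x 0).2] =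
        ∫ z, (z.1 - c * z.2) ∂Q := by
      conv_rhs => rw [← (hev 0).map_eq]
      rw [integral_map (hev 0).measurable.aemeasurable hX.aestronglyMeasurable]
      rfl
    rw [hmean] at h
    exact h
  · have hid : IdentDistrib (Function.eval i) (Function.eval 0 : (ℕ → ℝ × ℝ) → ℝ × ℝ)
        (pathLaw Q) (pathLaw Q) :=
      ⟨(hev i).measurable.aemeasurable, (hev 0).measurable.aemeasurable,
        (hev i).map_eq.trans (hev 0).map_eq.symm⟩
    exact hid.comp hX

lemma crossings_nonempty_of_tendsto {μ : ℝ} (hμ : 0 < μ) {x : ℕ → ℝ × ℝ}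
    (hx : Tendsto (fun n : ℕ => walk c x n / n) atTop (𝓝 μ)) (u : ℝ) :
    (crossings c u x).Nonempty := by
  have h : Tendsto (fun n : ℕ => walk c x n / n * n) atTop atTop :=
    hx.pos_mul_atTop hμ tendsto_natCast_atTop_atTop
  obtain ⟨n, hn, hn1⟩ := ((h.eventually_gt_atTop u).and (eventually_ge_atTop 1)).exists
  refine ⟨n, hn1, ?_⟩
  rwa [div_mul_cancel₀ _ (by positivity)] at hn

lemma ae_prod_rnDeriv_eq [IsProbabilityMeasure Q]
    (hrn : P.rnDeriv Q =ᵐ[Q] fun z => ENNReal.ofReal (Real.exp (-(w * (z.1 - c * z.2))))) :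
    ∀ᵐ x ∂pathLaw Q, ∀ n, ∏ k ∈ Finset.range n, P.rnDeriv Q (x k) =
      ENNReal.ofReal (Real.exp (-(w * walk c x n))) := by
  have h : ∀ᵐ x ∂pathLaw Q, ∀ k, P.rnDeriv Q (x k) =
      ENNReal.ofReal (Real.exp (-(w * ((x k).1 - c * (x k).2)))) :=
    ae_all_iff.2 fun k =>
      (measurePreserving_eval_infinitePi (fun _ : ℕ => Q) k).quasiMeasurePreserving.ae hrn
  filter_upwards [h] with x hx n
  simp_rw [hx]
  rw [← ENNReal.ofReal_prod_of_nonneg fun _ _ => by positivity, ← Real.exp_sum, walk,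
    Finset.mul_sum, Finset.sum_neg_distrib]

lemma ae_estimator_le [IsProbabilityMeasure Q] (hw : 0 < w)
    (hrn : P.rnDeriv Q =ᵐ[Q] fun z => ENNReal.ofReal (Real.exp (-(w * (z.1 - c * z.2))))) (u : ℝ) :
    ∀ᵐ x ∂pathLaw Q, estimator c P Q u x ≤ ENNReal.ofReal (Real.exp (-(w * u))) := by
  filter_upwards [ae_prod_rnDeriv_eq hrn] with x hx
  unfold estimator
  split_ifs with h
  · rw [hx]
    have := (Nat.sInf_mem h).2
    gcongr
  · exact zero_le

lemma secondMoment_le [IsProbabilityMeasure Q] (hw : 0 < w)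
    (hrn : P.rnDeriv Q =ᵐ[Q] fun z => ENNReal.ofReal (Real.exp (-(w * (z.1 - c * z.2))))) (u : ℝ) :
    secondMoment c P Q u ≤ ENNReal.ofReal (Real.exp (-(w * u))) ^ 2 := by
  calc secondMoment c P Q u
      ≤ ∫⁻ _, ENNReal.ofReal (Real.exp (-(w * u))) ^ 2 ∂pathLaw Q := by
        refine lintegral_mono_ae ?_
        filter_upwards [ae_estimator_le hw hrn u] with x hx
        gcongr
    _ = ENNReal.ofReal (Real.exp (-(w * u))) ^ 2 := by simp

/-- The upper barrier `v` keeps the likelihood ratio e^{-w S_n} from being too small. The time `n`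
is fixed, and being above `u` at that time already implies a crossing. -/
lemma exp_mul_measure_le [IsProbabilityMeasure P] [IsProbabilityMeasure Q] (hw : 0 < w)
    (hPQ : P ≪ Q)
    (hrn : P.rnDeriv Q =ᵐ[Q] fun z => ENNReal.ofReal (Real.exp (-(w * (z.1 - c * z.2)))))
    (u v : ℝ) {n : ℕ} (hn : 1 ≤ n) :
    ENNReal.ofReal (Real.exp (-(w * v))) * pathLaw Q {x | u < walk c x n ∧ walk c x n ≤ v} ≤
      pathLaw P {x | (crossings c u x).Nonempty} := by
  have hm : MeasurableSet {x | u < walk c x n ∧ walk c x n ≤ v} :=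
    (measurableSet_lt measurable_const (measurable_walk c n)).inter
      (measurableSet_le (measurable_walk c n) measurable_const)
  calc ENNReal.ofReal (Real.exp (-(w * v))) * pathLaw Q {x | u < walk c x n ∧ walk c x n ≤ v}
      = ∫⁻ _ in {x | u < walk c x n ∧ walk c x n ≤ v}, ENNReal.ofReal (Real.exp (-(w * v)))
          ∂pathLaw Q := by simp
    _ ≤ ∫⁻ x in {x | u < walk c x n ∧ walk c x n ≤ v}, ∏ k ∈ Finset.range n, P.rnDeriv Q (x k)
          ∂pathLaw Q := by
        refine setLIntegral_mono_ae' hm ?_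
        filter_upwards [ae_prod_rnDeriv_eq hrn] with x hx hxA
        rw [hx]
        have := hxA.2
        gcongr
    _ = pathLaw P {x | u < walk c x n ∧ walk c x n ≤ v} := by
        refine setLIntegral_prod_rnDeriv P Q hPQ n hm fun x y h => ?_
        have := dependsOn_walk c le_rfl h
        simp only at this
        simp [this]
    _ ≤ pathLaw P {x | (crossings c u x).Nonempty} :=
        measure_mono fun x hx => ⟨n, hn, hx.1⟩

/-- At this time the law of large numbers puts the walk near (1+δ/2)u, strictly inside the window
from u to (1+δ)u. -/
lemma tendsto_measure_walk [IsProbabilityMeasure Q] {μ δ : ℝ} (hμ : 0 < μ) (hδ : 0 < δ)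
    (hlln : ∀ᵐ x ∂pathLaw Q, Tendsto (fun n : ℕ => walk c x n / n) atTop (𝓝 μ)) :
    Tendsto (fun u : ℝ => pathLaw Q {x | u < walk c x ⌈(1 + δ / 2) / μ * u⌉₊ ∧
      walk c x ⌈(1 + δ / 2) / μ * u⌉₊ ≤ (1 + δ) * u}) atTop (𝓝 1) := by
  have ha : 0 < (1 + δ / 2) / μ := by positivity
  rw [← measure_univ (μ := pathLaw Q)]
  refine tendsto_measure_of_ae_tendsto_indicator_of_isFiniteMeasure atTop MeasurableSet.univ
    (fun u => (measurableSet_lt measurable_const (measurable_walk c _)).inter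
      (measurableSet_le (measurable_walk c _) measurable_const)) ?_
  filter_upwards [hlln] with x hx
  have hn : Tendsto (fun u : ℝ => ⌈(1 + δ / 2) / μ * u⌉₊) atTop atTop :=
    tendsto_nat_ceil_atTop.comp (tendsto_id.const_mul_atTop ha)
  have h1 := (hx.comp hn).mul (tendsto_nat_ceil_mul_div_atTop ha.le)
  have h2 : μ * ((1 + δ / 2) / μ) = 1 + δ / 2 := by field_simp
  rw [h2] at h1
  filter_upwards [h1.eventually_const_lt (u := 1) (by linarith),
    h1.eventually_lt_const (u := 1 + δ) (by linarith), eventually_gt_atTop 0,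
    hn.eventually_gt_atTop 0] with u hu1 hu2 hu hn0
  have hn0' : (⌈(1 + δ / 2) / μ * u⌉₊ : ℝ) ≠ 0 := by positivity
  have h3 : walk c x ⌈(1 + δ / 2) / μ * u⌉₊ / (⌈(1 + δ / 2) / μ * u⌉₊ : ℝ) *
      ((⌈(1 + δ / 2) / μ * u⌉₊ : ℝ) / u) = walk c x ⌈(1 + δ / 2) / μ * u⌉₊ / u := by
    field_simp
  simp only [Function.comp_apply, h3] at hu1 hu2
  rw [lt_div_iff₀ hu, one_mul] at hu1
  rw [div_lt_iff₀ hu] at hu2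
  simp only [Set.mem_univ, iff_true]
  exact ⟨hu1, hu2.le⟩

/-- The crossing probability of a high level `u` is at least of the order `e^{-wu}`. -/
lemma eventually_exp_le_measure_crossings [IsProbabilityMeasure P] [IsProbabilityMeasure Q]
    (hw : 0 < w) (hPQ : P ≪ Q)
    (hrn : P.rnDeriv Q =ᵐ[Q] fun z => ENNReal.ofReal (Real.exp (-(w * (z.1 - c * z.2)))))
    (hint : Integrable (fun z : ℝ × ℝ => z.1 - c * z.2) Q)
    (hpos : 0 < ∫ z, (z.1 - c * z.2) ∂Q) {δ : ℝ} (hδ : 0 < δ) :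
    ∀ᶠ u : ℝ in atTop, ENNReal.ofReal (Real.exp (-(w * ((1 + δ) * u)))) ≤
      pathLaw P {x | (crossings c u x).Nonempty} := by
  set μ := ∫ z, (z.1 - c * z.2) ∂Q
  -- Half of the margin is spent on the window for the walk; the other half, once wδu/2 ≥ 1, absorbs
  -- the lower bound e^{-1} for the probability of that window.
  have hδ2 : 0 < δ / 2 := by positivity
  have hhalf : ENNReal.ofReal (Real.exp (-1)) < 1 := by
    rw [ENNReal.ofReal_lt_one, Real.exp_lt_one_iff]
    norm_num
  filter_upwards [(tendsto_measure_walk hpos hδ2 (tendsto_walk_div hint)).eventually_const_lt hhalf,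
    eventually_gt_atTop 0, eventually_ge_atTop (1 / (w * (δ / 2)))] with u hu hu0 hu1
  have hn : 1 ≤ ⌈(1 + δ / 2 / 2) / μ * u⌉₊ := Nat.one_le_ceil_iff.2 (by positivity)
  rw [div_le_iff₀ (by positivity)] at hu1
  calc ENNReal.ofReal (Real.exp (-(w * ((1 + δ) * u))))
      ≤ ENNReal.ofReal (Real.exp (-(w * ((1 + δ / 2) * u))) * Real.exp (-1)) := by
        rw [← Real.exp_add]
        gcongr
        linarith
    _ = ENNReal.ofReal (Real.exp (-(w * ((1 + δ / 2) * u)))) * ENNReal.ofReal (Real.exp (-1)) :=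
        ENNReal.ofReal_mul (by positivity)
    _ ≤ ENNReal.ofReal (Real.exp (-(w * ((1 + δ / 2) * u)))) * _ := by
        gcongr
    _ ≤ _ := exp_mul_measure_le hw hPQ hrn u _ hn

end ExponentialChange

/-! ### The tilted law and the consequences of (C1) -/

section Tilting

variable {c w : ℝ} {PU PT : Measure ℝ}

lemma tiltedLaw_eq_tilted [IsProbabilityMeasure PU] [IsProbabilityMeasure PT] (c w : ℝ) :
    tiltedLaw c PU PT w = (PU.prod PT).tilted fun z => w * (z.1 - c * z.2) := by
  have hexp : ∀ z : ℝ × ℝ, Real.exp (w * (z.1 - c * z.2)) =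
      Real.exp (w * z.1) * Real.exp (-c * w * z.2) := fun z => by
    rw [← Real.exp_add]
    ring_nf
  unfold tiltedLaw Measure.tilted
  rw [prod_withDensity (by fun_prop) (by fun_prop)]
  congr 1
  ext z
  simp_rw [hexp]
  rw [integral_prod_mul (fun x => Real.exp (w * x)) (fun t => Real.exp (-c * w * t)),
    ← ENNReal.ofReal_mul (by positivity), div_mul_div_comm]

lemma integrable_exp_mul_of_cumulant_lt_top [IsProbabilityMeasure PU] [IsProbabilityMeasure PT]
    (hc : 0 < c) (hT : ∀ᵐ t ∂PT, 0 < t) {θ : ℝ} (hθ : 0 < θ) (h : cumulant c PU PT θ < ⊤) :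
    Integrable (fun z : ℝ × ℝ => Real.exp (θ * (z.1 - c * z.2))) (PU.prod PT) := by
  have hT' : Integrable (fun t => Real.exp (-c * θ * t)) PT := by
    refine Integrable.of_bound (by fun_prop) 1 ?_
    filter_upwards [hT] with t ht
    rw [Real.norm_of_nonneg (by positivity), Real.exp_le_one_iff]
    nlinarith [mul_pos hc hθ, mul_pos (mul_pos hc hθ) ht]
  -- Needed because ⊤ + ⊥ = ⊥ in `EReal`: otherwise a finite cumulant would not exclude an infinite
  -- moment of U.
  have hne : ENNReal.log (∫⁻ t, ENNReal.ofReal (Real.exp (-c * θ * t)) ∂PT) ≠ ⊥ := by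
    rw [Ne, ENNReal.log_eq_bot_iff, lintegral_eq_zero_iff (by fun_prop)]
    intro h0
    obtain ⟨t, ht⟩ := h0.exists
    simp only [Pi.zero_apply, ENNReal.ofReal_eq_zero, not_le.2 (Real.exp_pos _)] at ht
  have hU : Integrable (fun x => Real.exp (θ * x)) PU := by
    refine (lintegral_ofReal_ne_top_iff_integrable (by fun_prop)
      (ae_of_all _ fun _ => by positivity)).1 fun htop => h.ne ?_
    rw [cumulant, htop, ENNReal.log_top, EReal.top_add_of_ne_bot hne]
  refine (hU.mul_prod hT').congr (ae_of_all _ fun z => ?_)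
  simp only
  rw [← Real.exp_add]
  ring_nf

lemma mem_interior_integrableExpSet [IsProbabilityMeasure PU] [IsProbabilityMeasure PT]
    (hc : 0 < c) (hT : ∀ᵐ t ∂PT, 0 < t) (hw0 : 0 < w)
    (hwint : w ∈ interior {θ : ℝ | cumulant c PU PT θ < ⊤}) :
    w ∈ interior (integrableExpSet (fun z : ℝ × ℝ => z.1 - c * z.2) (PU.prod PT)) := by
  rw [mem_interior_iff_mem_nhds] at hwint ⊢
  filter_upwards [hwint, lt_mem_nhds hw0] with θ hθ hθ0
  exact integrable_exp_mul_of_cumulant_lt_top hc hT hθ0 hθ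

lemma integral_exp_eq_one [IsProbabilityMeasure PU] [IsProbabilityMeasure PT]
    (hw : cumulant c PU PT w = 0) :
    ∫ z : ℝ × ℝ, Real.exp (w * (z.1 - c * z.2)) ∂(PU.prod PT) = 1 := by
  rw [cumulant, ← ENNReal.log_mul_add, ENNReal.log_eq_one_iff,
    ← lintegral_prod_mul (by fun_prop) (by fun_prop)] at hw
  rw [integral_eq_lintegral_of_nonneg_ae (ae_of_all _ fun _ => by positivity) (by fun_prop)]
  have : ∀ z : ℝ × ℝ, ENNReal.ofReal (Real.exp (w * (z.1 - c * z.2))) =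
      ENNReal.ofReal (Real.exp (w * z.1)) * ENNReal.ofReal (Real.exp (-c * w * z.2)) := fun z => by
    rw [← ENNReal.ofReal_mul (by positivity), ← Real.exp_add]
    ring_nf
  simp_rw [this, hw]
  simp

end Tilting

lemma rnDeriv_tilted_of_integral_eq_one {α : Type*} [MeasurableSpace α] {μ : Measure α}
    [IsProbabilityMeasure μ] {f : α → ℝ} (hf : Integrable (fun x => Real.exp (f x)) μ)
    (h1 : ∫ x, Real.exp (f x) ∂μ = 1) :
    μ.rnDeriv (μ.tilted f) =ᵐ[μ.tilted f] fun x => ENNReal.ofReal (Real.exp (-f x)) := by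
  refine (tilted_absolutelyContinuous μ f).ae_le ?_
  filter_upwards [rnDeriv_tilted_right μ μ hf, Measure.rnDeriv_self μ] with x hx hx1
  rw [hx, hx1, h1, mul_one, mul_one]

/-- Given U = x, the increment vanishes only at T = x/c, which is not an atom. -/
lemma not_ae_increment_eq_zero {c : ℝ} (hc : 0 < c) {PU PT : Measure ℝ} [IsProbabilityMeasure PU]
    [IsProbabilityMeasure PT] [NullSingletonClass PT] :
    ¬ ∀ᵐ z ∂(PU.prod PT), z.1 - c * z.2 = 0 := by
  intro h
  obtain ⟨x, hx⟩ := (Measure.ae_ae_of_ae_prod h).exists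
  obtain ⟨t, ht, ht'⟩ := (hx.and (Measure.ae_ne PT (x / c))).exists
  simp only at ht
  exact ht' (by field_simp; linarith)

lemma holdingLaw_absolutelyContinuous (ν h lam : ℝ) : holdingLaw ν h lam ≪ volume :=
  withDensity_absolutelyContinuous _ _

lemma ae_holdingLaw_pos (ν h lam : ℝ) : ∀ᵐ t ∂holdingLaw ν h lam, 0 < t := by
  rw [ae_iff]
  have : {t : ℝ | ¬ 0 < t} = Set.Iic 0 := by ext; simp
  rw [this, holdingLaw, withDensity_apply _ measurableSet_Iic,
    setLIntegral_congr_fun (g := 0) measurableSet_Iic]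
  · simp
  · intro t ht
    simp [holdingDensity, not_lt.2 (Set.mem_Iic.1 ht)]

/-! ### From the reserve process to the law of the random walk -/

section Paths

variable {Ω : Type*}

/-- Two independent i.i.d. sequences form an i.i.d. sequence of pairs. -/
lemma map_pairs_eq_pathLaw [MeasurableSpace Ω] (P : Measure Ω) [IsProbabilityMeasure P] {U T : ℕ → Ω → ℝ}
    (hUm : ∀ k, Measurable (U k)) (hTm : ∀ n, Measurable (T n))
    (hUind : iIndepFun U P) (hTind : iIndepFun T P)
    (hUT : IndepFun (fun ω k => U k ω) (fun ω n => T n ω) P)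
    {PU PT : Measure ℝ} [IsProbabilityMeasure PU] [IsProbabilityMeasure PT]
    (hU : ∀ k, P.map (U k) = PU) (hT : ∀ k, P.map (T k) = PT) :
    P.map (fun ω k => (U k ω, T k ω)) = pathLaw (PU.prod PT) := by
  have hUs : Measurable fun ω k => U k ω := measurable_pi_lambda _ hUm
  have hTs : Measurable fun ω k => T k ω := measurable_pi_lambda _ hTm
  have hjoint : P.map (fun ω => ((fun k => U k ω), fun k => T k ω)) =
      (Measure.infinitePi fun _ : ℕ => PU).prod (Measure.infinitePi fun _ : ℕ => PT) := by
    rw [(indepFun_iff_map_prod_eq_prod_map_map hUs.aemeasurable hTs.aemeasurable).1 hUT,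
      hUind.map_fun_eq_infinitePi_map hUm, hTind.map_fun_eq_infinitePi_map hTm]
    simp_rw [hU, hT]
  let zip : (ℕ → ℝ) × (ℕ → ℝ) → ℕ → ℝ × ℝ := fun p k => (p.1 k, p.2 k)
  have hzip : Measurable zip := by fun_prop
  have hcomp : P.map (fun ω k => (U k ω, T k ω)) =
      (P.map (fun ω => ((fun k => U k ω), fun k => T k ω))).map zip := by
    rw [Measure.map_map hzip (hUs.prodMk hTs)]
    rfl
  rw [hcomp, hjoint]
  refine Measure.eq_infinitePi _ fun s C hC => ?_
  have hbox : MeasurableSet (Set.pi (s : Set ℕ) C) := .pi s.countable_toSet fun _ _ => hC _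
  rw [Measure.map_apply hzip hbox, Measure.prod_apply (hzip hbox)]
  have hslice : ∀ a : ℕ → ℝ, (Measure.infinitePi fun _ : ℕ => PT)
      (Prod.mk a ⁻¹' (zip ⁻¹' Set.pi (s : Set ℕ) C)) =
      ∏ k ∈ s, PT (Prod.mk (a k) ⁻¹' C k) := by
    intro a
    rw [← Measure.infinitePi_pi (fun _ : ℕ => PT) (t := fun k => Prod.mk (a k) ⁻¹' C k)
      fun k _ => measurable_prodMk_left (hC k)]
    rfl
  simp_rw [hslice]
  have hm : ∀ k, Measurable fun y : ℝ => PT (Prod.mk y ⁻¹' C k) := fun k =>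
    measurable_measure_prodMk_left (hC k)
  rw [lintegral_prod_eq_prod_lintegral_of_indepFun s
    (fun k (a : ℕ → ℝ) => PT (Prod.mk (a k) ⁻¹' C k))
    (iIndepFun_infinitePi (P := fun _ : ℕ => PU) hm) fun k => (hm k).comp (measurable_pi_apply k)]
  refine Finset.prod_congr rfl fun k _ => ?_
  rw [(measurePreserving_eval_infinitePi (fun _ : ℕ => PU) k).lintegral_comp (hm k),
    Measure.prod_apply (hC k)]

/-- Ruin occurs if and only if the walk of the claim sizes minus the premiums crosses the initial
capital. -/
lemma ruin_iff_crossings_nonempty {c u : ℝ} (hc : 0 < c) (hu : 0 < u) {U T : ℕ → Ω → ℝ} {ω : Ω}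
    (hT : ∀ k, 0 < T k ω) :
    (∃ t : ℝ, 0 ≤ t ∧ reserve c u U T t ω < 0) ↔
      (crossings c u fun k => (U k ω, T k ω)).Nonempty := by
  have hmono : StrictMono fun n => ∑ k ∈ Finset.range n, T k ω := by
    refine strictMono_nat_of_lt_succ fun n => ?_
    rw [Finset.sum_range_succ]
    linarith [hT n]
  have hwalk : ∀ n, walk c (fun k => (U k ω, T k ω)) n =
      ∑ k ∈ Finset.range n, U k ω - c * ∑ k ∈ Finset.range n, T k ω := fun n => by
    rw [walk, Finset.sum_sub_distrib, Finset.mul_sum]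
  constructor
  · rintro ⟨t, ht, hr⟩
    rw [reserve] at hr
    set N := claimNumber T t ω with hN
    -- Without claims the reserve is at least u > 0. As `Set.ncard` is 0 on infinite sets, this also
    -- shows that only finitely many claims arrive by time t.
    have hN0 : N ≠ 0 := by
      intro h0
      rw [h0, Finset.range_zero, Finset.sum_empty] at hr
      nlinarith [mul_nonneg hc.le ht]
    have hfin : {n : ℕ | 1 ≤ n ∧ ∑ k ∈ Finset.range n, T k ω ≤ t}.Finite :=
      Set.finite_of_ncard_ne_zero hN0
    obtain ⟨m, hm, hmax⟩ := hfin.exists_maximal (Set.nonempty_of_ncard_ne_zero hN0)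
    have hNm : N ≤ m := by
      have hsub : {n : ℕ | 1 ≤ n ∧ ∑ k ∈ Finset.range n, T k ω ≤ t} ⊆
          (Finset.Icc 1 m : Finset ℕ) := by
        intro n hn
        rw [Finset.coe_Icc]
        exact ⟨hn.1, (le_total n m).elim id (hmax hn)⟩
      have := Set.ncard_le_ncard hsub
      rwa [Set.ncard_coe_finset, Nat.card_Icc, Nat.add_sub_cancel] at this
    refine ⟨N, Nat.one_le_iff_ne_zero.2 hN0, ?_⟩
    have := hmono.monotone hNm
    have hsum : ∑ k ∈ Finset.range N, T k ω ≤ t := this.trans hm.2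
    rw [hwalk]
    nlinarith [mul_le_mul_of_nonneg_left hsum hc.le]
  · rintro ⟨n, hn, hlt⟩
    -- Ruin is tested at the n-th claim time, when exactly n claims have arrived because the claim
    -- times strictly increase.
    refine ⟨∑ k ∈ Finset.range n, T k ω, Finset.sum_nonneg fun k _ => (hT k).le, ?_⟩
    have hset : {m : ℕ | 1 ≤ m ∧ ∑ k ∈ Finset.range m, T k ω ≤ ∑ k ∈ Finset.range n, T k ω} =
        (Finset.Icc 1 n : Finset ℕ) := by
      ext m
      rw [Finset.coe_Icc]
      exact and_congr_right fun _ => hmono.le_iff_le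
    rw [reserve, claimNumber, hset, Set.ncard_coe_finset, Nat.card_Icc, Nat.add_sub_cancel]
    rw [hwalk] at hlt
    linarith

lemma ruinProb_eq_pathLaw [MeasurableSpace Ω] (P : Measure Ω) {c u : ℝ} (hc : 0 < c) (hu : 0 < u)
    {U T : ℕ → Ω → ℝ}
    (hUm : ∀ k, Measurable (U k)) (hTm : ∀ n, Measurable (T n))
    (hT : ∀ k, ∀ᵐ ω ∂P, 0 < T k ω) {Q : Measure (ℝ × ℝ)}
    (hlaw : P.map (fun ω k => (U k ω, T k ω)) = pathLaw Q) :
    ruinProb P c U T u = pathLaw Q {x | (crossings c u x).Nonempty} := by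
  have hm : MeasurableSet {x | (crossings c u x).Nonempty} := by
    rw [← iUnion_firstCrossing]
    exact .iUnion fun n => measurableSet_firstCrossing c u n
  rw [← hlaw, Measure.map_apply (by fun_prop) hm, ruinProb]
  refine measure_congr ?_
  filter_upwards [ae_all_iff.2 hT] with ω hω
  exact propext (ruin_iff_crossings_nonempty hc hu hω)

end Paths

/-- A function between `e^{-w(1+δ)u}` for all `δ > 0`, and `e^{-wu}`, has exponential rate `-w`. -/
lemma tendsto_log_div_of_exp_bounds {w : ℝ} (hw : 0 < w) {f : ℝ → ℝ≥0∞}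
    (hupper : ∀ u, f u ≤ ENNReal.ofReal (Real.exp (-(w * u))))
    (hlower : ∀ δ > 0, ∀ᶠ u : ℝ in atTop,
      ENNReal.ofReal (Real.exp (-(w * ((1 + δ) * u)))) ≤ f u) :
    (∀ᶠ u in atTop, ENNReal.log (f u) = (Real.log (f u).toReal : EReal)) ∧
      Tendsto (fun u => Real.log (f u).toReal / u) atTop (𝓝 (-w)) := by
  have htop : ∀ u, f u ≠ ⊤ := fun u => ne_top_of_le_ne_top ENNReal.ofReal_ne_top (hupper u)
  have hpos : ∀ δ > 0, ∀ᶠ u : ℝ in atTop, f u ≠ 0 ∧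
      -(w * ((1 + δ) * u)) ≤ Real.log (f u).toReal := by
    intro δ hδ
    filter_upwards [hlower δ hδ] with u hu
    have h0 : f u ≠ 0 := ((ENNReal.ofReal_pos.2 (Real.exp_pos _)).trans_le hu).ne'
    refine ⟨h0, (Real.le_log_iff_exp_le (ENNReal.toReal_pos h0 (htop u))).2 ?_⟩
    exact (ENNReal.ofReal_le_iff_le_toReal (htop u)).1 hu
  refine ⟨?_, ?_⟩
  · filter_upwards [hpos 1 one_pos] with u hu
    exact ENNReal.log_pos_real hu.1 (htop u)
  · refine tendsto_order.2 ⟨fun a ha => ?_, fun a ha => ?_⟩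
    · have hδ : 0 < (-w - a) / (2 * w) := div_pos (by linarith) (by linarith)
      filter_upwards [hpos _ hδ, eventually_gt_atTop 0] with u hu hu0
      rw [lt_div_iff₀ hu0]
      refine lt_of_lt_of_le ?_ hu.2
      have : w * ((1 + (-w - a) / (2 * w)) * u) = (w + (-w - a) / 2) * u := by field_simp
      rw [this]
      nlinarith
    · filter_upwards [hpos 1 one_pos, eventually_gt_atTop 0] with u hu hu0
      refine lt_of_le_of_lt ?_ ha
      rw [div_le_iff₀ hu0, neg_mul]
      refine (Real.log_le_iff_le_exp (ENNReal.toReal_pos hu.1 (htop u))).2 ?_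
      exact ENNReal.toReal_le_of_le_ofReal (Real.exp_pos _).le (hupper u)

lemma tendsto_ennrealLog_div_of_exp_bounds {w : ℝ} (hw : 0 < w) {f : ℝ → ℝ≥0∞}
    (hupper : ∀ u, f u ≤ ENNReal.ofReal (Real.exp (-(w * u))))
    (hlower : ∀ δ > 0, ∀ᶠ u : ℝ in atTop,
      ENNReal.ofReal (Real.exp (-(w * ((1 + δ) * u)))) ≤ f u) :
    Tendsto (fun u : ℝ => ENNReal.log (f u) / (u : EReal)) atTop (𝓝 ((-w : ℝ) : EReal)) := by
  obtain ⟨h1, h2⟩ := tendsto_log_div_of_exp_bounds hw hupper hlower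
  refine (EReal.tendsto_coe.2 h2).congr' ?_
  filter_upwards [h1] with u hu
  rw [hu, EReal.coe_div]

lemma ofReal_exp_sq (a : ℝ) :
    ENNReal.ofReal (Real.exp a) ^ 2 = ENNReal.ofReal (Real.exp (2 * a)) := by
  rw [← ENNReal.ofReal_pow (Real.exp_pos _).le, ← Real.exp_nat_mul]
  norm_num

/-! ### Asymptotic optimality of exponential changes of measure -/

section Optimality

variable {c w : ℝ} {P Q : Measure (ℝ × ℝ)}

/-- An exponential change of measure under which the walk has a positive drift is asymptotically
optimal. -/
theorem isAsymptoticallyOptimal_of_exponential_change [IsProbabilityMeasure P]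
    [IsProbabilityMeasure Q] (hw : 0 < w) (hPQ : P ≪ Q)
    (hrn : P.rnDeriv Q =ᵐ[Q] fun z => ENNReal.ofReal (Real.exp (-(w * (z.1 - c * z.2)))))
    (hint : Integrable (fun z : ℝ × ℝ => z.1 - c * z.2) Q)
    (hne : ¬ ∀ᵐ z ∂Q, z.1 - c * z.2 = 0) {Ψ : ℝ → ℝ≥0∞}
    (hΨ : ∀ u, 0 < u → Ψ u = pathLaw P {x | (crossings c u x).Nonempty}) :
    IsAsymptoticallyOptimal c Ψ P Q := by
  have hpos := integral_increment_pos hw hPQ hrn hint hne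
  have hw2 : 0 < 2 * w := by positivity
  let ψ : ℝ → ℝ≥0∞ := fun u => pathLaw P {x | (crossings c u x).Nonempty}
  have hψu : ∀ u, ψ u ≤ ENNReal.ofReal (Real.exp (-(w * u))) := fun u => by
    calc ψ u = ∫⁻ x, estimator c P Q u x ∂pathLaw Q := (lintegral_estimator c P Q hPQ u).symm
      _ ≤ ∫⁻ _, ENNReal.ofReal (Real.exp (-(w * u))) ∂pathLaw Q :=
        lintegral_mono_ae (ae_estimator_le hw hrn u)
      _ = ENNReal.ofReal (Real.exp (-(w * u))) := by simp
  have hψl : ∀ δ > 0, ∀ᶠ u : ℝ in atTop,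
      ENNReal.ofReal (Real.exp (-(w * ((1 + δ) * u)))) ≤ ψ u := fun δ hδ =>
    eventually_exp_le_measure_crossings hw hPQ hrn hint hpos hδ
  have hψ2l : ∀ δ > 0, ∀ᶠ u : ℝ in atTop,
      ENNReal.ofReal (Real.exp (-(2 * w * ((1 + δ) * u)))) ≤ ψ u ^ 2 := fun δ hδ => by
    filter_upwards [hψl δ hδ] with u hu
    calc ENNReal.ofReal (Real.exp (-(2 * w * ((1 + δ) * u))))
        = ENNReal.ofReal (Real.exp (-(w * ((1 + δ) * u)))) ^ 2 := by
          rw [ofReal_exp_sq]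
          ring_nf
      _ ≤ ψ u ^ 2 := by gcongr
  have hmu : ∀ u, secondMoment c P Q u ≤ ENNReal.ofReal (Real.exp (-(2 * w * u))) := fun u => by
    refine (secondMoment_le hw hrn u).trans_eq ?_
    rw [ofReal_exp_sq]
    ring_nf
  have hml : ∀ δ > 0, ∀ᶠ u : ℝ in atTop,
      ENNReal.ofReal (Real.exp (-(2 * w * ((1 + δ) * u)))) ≤ secondMoment c P Q u := fun δ hδ => by
    filter_upwards [hψ2l δ hδ] with u hu
    exact hu.trans (sq_le_secondMoment c P Q hPQ u)
  refine ⟨⟨inferInstance, hPQ⟩, fun u _ => ?_, fun u hu => ?_, ?_, fun Q' hQ' => ?_⟩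
  · filter_upwards [tendsto_walk_div hint] with x hx
    exact crossings_nonempty_of_tendsto hpos hx u
  · rw [hΨ u hu, lintegral_estimator c P Q hPQ]
  · obtain ⟨h1, h2⟩ := tendsto_log_div_of_exp_bounds hw hψu hψl
    obtain ⟨h3, h4⟩ := tendsto_log_div_of_exp_bounds hw2 hmu hml
    have h5 := h4.div h2 (neg_ne_zero.2 hw.ne')
    have h6 : -(2 * w) / -w = 2 := by field_simp
    rw [h6] at h5
    refine (EReal.tendsto_coe.2 h5).congr' ?_
    filter_upwards [h1, h3, eventually_gt_atTop 0] with u hu1 hu3 hu0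
    rw [hΨ u hu0, hu1, hu3, ← EReal.coe_div, Pi.div_apply, div_div_div_cancel_right₀ hu0.ne']
  · have := hQ'.isProbabilityMeasure
    -- The square of the crossing probability has the same rate -2w as the second moment under `Q`,
    -- and it bounds the second moment under every `Q'` from below.
    have hsq : Tendsto (fun u : ℝ => ENNReal.log (ψ u ^ 2) / (u : EReal)) atTop
        (𝓝 ((-(2 * w) : ℝ) : EReal)) := by
      refine tendsto_ennrealLog_div_of_exp_bounds hw2 (fun u => ?_) hψ2l
      exact (sq_le_secondMoment c P Q hPQ u).trans (hmu u)
    rw [(tendsto_ennrealLog_div_of_exp_bounds hw2 hmu hml).limsup_eq, ← hsq.liminf_eq]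
    refine liminf_le_liminf ?_
    filter_upwards [eventually_ge_atTop 0] with u hu
    exact EReal.div_le_div_right_of_nonneg (EReal.coe_nonneg.2 hu)
      (ENNReal.log_le_log (sq_le_secondMoment c P Q' hQ'.absolutelyContinuous u))

end Optimality

end FractionalRuin

/-! ### Application to the risk model -/

theorem mainTheorem4 {Ω : Type*} [MeasurableSpace Ω] (P : Measure Ω) [IsProbabilityMeasure P]
    (ν h lam c : ℝ) (hν0 : 0 < ν) (hν1 : ν < 1) (hh : 0 < h) (hlam : 0 < lam) (hc : 0 < c)
    (U T : ℕ → Ω → ℝ)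
    (hUm : ∀ k, Measurable (U k)) (hTm : ∀ n, Measurable (T n))
    -- the claim sizes are i.i.d. and positive
    (hUind : iIndepFun U P) (hUid : ∀ k, IdentDistrib (U k) (U 0) P P)
    (hUpos : ∀ k, ∀ᵐ ω ∂P, 0 < U k ω)
    -- the holding times are i.i.d. with the generalized Mittag-Leffler distribution
    (hTind : iIndepFun T P) (hTlaw : ∀ n, P.map (T n) = FractionalRuin.holdingLaw ν h lam)
    -- the claim sizes are independent of the holding times
    (hUT : IndepFun (fun ω k => U k ω) (fun ω n => T n ω) P)
    -- the condition (C1)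
    (w : ℝ) (hw0 : 0 < w)
    (hwint : w ∈ interior {θ : ℝ |
      FractionalRuin.cumulant c (P.map (U 0)) (FractionalRuin.holdingLaw ν h lam) θ < ⊤})
    (hw : FractionalRuin.cumulant c (P.map (U 0)) (FractionalRuin.holdingLaw ν h lam) w = 0) :
    FractionalRuin.IsAsymptoticallyOptimal c
      (FractionalRuin.ruinProb P c U T)
      ((P.map (U 0)).prod (FractionalRuin.holdingLaw ν h lam))
      (FractionalRuin.tiltedLaw c (P.map (U 0)) (FractionalRuin.holdingLaw ν h lam) w) := by
  have hPT : IsProbabilityMeasure (FractionalRuin.holdingLaw ν h lam) :=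
    hTlaw 0 ▸ Measure.isProbabilityMeasure_map (hTm 0).aemeasurable
  have hPU : IsProbabilityMeasure (P.map (U 0)) :=
    Measure.isProbabilityMeasure_map (hUm 0).aemeasurable
  have hatom : NullSingletonClass (FractionalRuin.holdingLaw ν h lam) :=
    ⟨fun t => FractionalRuin.holdingLaw_absolutelyContinuous ν h lam (measure_singleton t)⟩
  have hTpos := FractionalRuin.ae_holdingLaw_pos ν h lam
  have hmem := FractionalRuin.mem_interior_integrableExpSet hc hTpos hw0 hwint
  have hexp := interior_subset hmem
  have hac := absolutelyContinuous_tilted hexp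
  have hlaw := FractionalRuin.map_pairs_eq_pathLaw P hUm hTm hUind hTind hUT
    (fun k => (hUid k).map_eq) hTlaw
  have hTpos' : ∀ k, ∀ᵐ ω ∂P, 0 < T k ω := fun k => by
    refine ae_of_ae_map (hTm k).aemeasurable ?_
    rwa [hTlaw k]
  rw [FractionalRuin.tiltedLaw_eq_tilted]
  have := isProbabilityMeasure_tilted hexp
  refine FractionalRuin.isAsymptoticallyOptimal_of_exponential_change hw0 hac
    (FractionalRuin.rnDeriv_tilted_of_integral_eq_one hexp
      (FractionalRuin.integral_exp_eq_one hw)) ?_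
    (fun h0 => FractionalRuin.not_ae_increment_eq_zero hc (hac.ae_le h0))
    fun u hu => FractionalRuin.ruinProb_eq_pathLaw P hc hu hUm hTm hTpos' hlaw
  -- The tilted mean exists because `w` is interior: a slightly larger or smaller exponent dominates
  -- X e^{wX}.
  rw [integrable_tilted_iff hexp]
  refine (integrable_pow_mul_exp_of_mem_interior_integrableExpSet hmem 1).congr
    (ae_of_all _ fun z => ?_)
  simp only [pow_one, smul_eq_mul, mul_comm]
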